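/- **Proposition P2 (general bound, symmetric case).** Let $c>0$, let $A\in\mathbb{R}^{n\times n}$ be symmetric with all eigenvalues in $[0,2c]$, and let $g,v\in\mathbb{R}^n$ be such that $\tilde g:=g-Av$ has $\|\tilde g\|=1$ (Euclidean norm). Consider the initial value problem $y'(t)=-Ay(t)+g$, $y(0)=v$. Let $v_1=\tilde g/\|\tilde g\|,v_2,\dots,v_k$ be the vectors produced by the Arnoldi process, i.e. $h_{j+1,j}v_{j+1}=Av_j-\sum_{i=1}^{j}(v_i^TAv_j)v_i$, where $h_{j+1,j}\ge 0$ is the norm of the right-hand side (if $h_{j+1,j}=0$, put $v_{j+1}=0$); let $V_k=[v_1,\dots,v_k]$ and $H_k=V_k^TAV_k$. Let $\varphi$ be the entire function $\varphi(z)=(e^z-1)/z$, $\varphi(0)=1$, let $$y_k(t)=v+V_k\,t\,\varphi(-tH_k)\,(\|\tilde g\|e_1)$$ be the Krylov subspace approximation to $y(t)$ and $$r_k(t)=-Ay_k(t)+g-y_k'(t)$$ its residual. Then for all $k\ge 2$ and $t\ge 0$ $$\|r_k(t)\|\le 4e^{-ct}\sum_{\nu=k}^{\infty}(\nu-k+2)(\nu-k+1)\,I_\nu(ct),$$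 where $I_\nu(x)=\sum_{m\ge 0}\frac{(x/2)^{2m+\nu}}{m!\,(m+\nu)!}$ are the modified Bessel functions of the first kind; in particular, $y_k$ is differentiable at $t$ and the series on the right converges. -/

import Mathlib

open scoped Nat

noncomputable section

/-- The vectors `v₁, v₂, …` of the Arnoldi process for the matrix `A` and the vector `g`, indexed
from `0`: the first one is `g / ‖g‖`; the next one is obtained by orthogonalizing `A v_j` against
all vectors found so far and dividing the result by its norm `h_{j+1,j}`.  If the process breaks
down, i.e. `h_{j+1,j} = 0`, the next vectors are zero. -/
def arnoldiVec {n : ℕ} (A : Matrix (Fin n) (Fin n) ℝ) (g : EuclideanSpace ℝ (Fin n)) :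
    ℕ → EuclideanSpace ℝ (Fin n)
  | 0 => ‖g‖⁻¹ • g
  | j + 1 =>
    let w : EuclideanSpace ℝ (Fin n) := A.toEuclideanLin (arnoldiVec A g j) -
      ∑ i : Fin (j + 1),
        inner ℝ (arnoldiVec A g i) (A.toEuclideanLin (arnoldiVec A g j)) • arnoldiVec A g i
    ‖w‖⁻¹ • w
termination_by j => j
decreasing_by all_goals omega

/-- The matrix `V_k` whose columns are the first `k` Arnoldi vectors. -/
def arnoldiBasis {n : ℕ} (A : Matrix (Fin n) (Fin n) ℝ) (g : EuclideanSpace ℝ (Fin n)) (k : ℕ) :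
    Matrix (Fin n) (Fin k) ℝ :=
  Matrix.of fun i j => arnoldiVec A g j i

/-- The projected matrix `H_k = V_kᵀ A V_k`. -/
def arnoldiHess {n : ℕ} (A : Matrix (Fin n) (Fin n) ℝ) (g : EuclideanSpace ℝ (Fin n)) (k : ℕ) :
    Matrix (Fin k) (Fin k) ℝ :=
  (arnoldiBasis A g k).transpose * A * arnoldiBasis A g k

/-- The matrix function `φ` for the entire function `φ(z) = (e ^ z - 1) / z`, `φ(0) = 1`, given by
its power series `φ(M) = ∑ M ^ j / (j + 1)!`. -/
def phiMatrix {k : ℕ} (M : Matrix (Fin k) (Fin k) ℝ) : Matrix (Fin k) (Fin k) ℝ :=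
  ∑' j : ℕ, ((j + 1)! : ℝ)⁻¹ • M ^ j

/-- The power series of `φ` converges for every matrix. -/
theorem summable_phiMatrix {k : ℕ} (M : Matrix (Fin k) (Fin k) ℝ) :
    Summable fun j : ℕ => ((j + 1)! : ℝ)⁻¹ • M ^ j := by
  let _ : NormedRing (Matrix (Fin k) (Fin k) ℝ) := Matrix.linftyOpNormedRing
  let _ : NormedAlgebra ℝ (Matrix (Fin k) (Fin k) ℝ) := Matrix.linftyOpNormedAlgebra
  have h := NormedSpace.norm_expSeries_summable' (𝕂 := ℝ) M
  refine Summable.of_norm_bounded h fun j => ?_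
  rw [norm_smul, norm_smul]
  gcongr
  rw [Real.norm_of_nonneg (by positivity), Real.norm_of_nonneg (by positivity)]
  gcongr
  omega

/-- `z φ(z) = e ^ z - 1` for the matrix function `φ`. -/
theorem mul_phiMatrix {k : ℕ} (M : Matrix (Fin k) (Fin k) ℝ) :
    M * phiMatrix M = NormedSpace.exp M - 1 := by
  let _ : NormedRing (Matrix (Fin k) (Fin k) ℝ) := Matrix.linftyOpNormedRing
  let _ : NormedAlgebra ℝ (Matrix (Fin k) (Fin k) ℝ) := Matrix.linftyOpNormedAlgebra
  have h : HasSum (fun j : ℕ => M * ((((j + 1)! : ℕ) : ℝ)⁻¹ • M ^ j)) (M * phiMatrix M) :=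
    (summable_phiMatrix M).hasSum.mul_left M
  have h2 := NormedSpace.exp_series_hasSum_exp' (𝕂 := ℝ) M
  rw [← hasSum_nat_add_iff' 1] at h2
  simp only [Finset.sum_range_one, pow_zero, Nat.factorial_zero, Nat.cast_one, inv_one,
    one_smul] at h2
  refine h.unique ?_
  have h3 : (fun j : ℕ => M * ((((j + 1)! : ℕ) : ℝ)⁻¹ • M ^ j)) =
      fun j : ℕ => (((j + 1)! : ℕ) : ℝ)⁻¹ • M ^ (j + 1) := by
    funext j
    rw [mul_smul_comm, pow_succ']
  rw [h3]
  exact h2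

/-- The vector `u(t) = t φ(-t H_k) (β e₁)`, `β = ‖g‖`, solving the projected problem. -/
def krylovCoeff {n : ℕ} (A : Matrix (Fin n) (Fin n) ℝ) (g : EuclideanSpace ℝ (Fin n)) (k : ℕ)
    (t : ℝ) : Fin k → ℝ :=
  t • (phiMatrix ((-t) • arnoldiHess A g k)).mulVec
    (‖g‖ • fun i : Fin k => if (i : ℕ) = 0 then (1 : ℝ) else 0)

/-- The `k`-step Krylov subspace approximation `y_k(t) = v + V_k u(t)` to the solution of
`y' = -A y + g`, `y(0) = v`.  Here `V_k` and `u` belong to `A` and the vector `g - A v`. -/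
def krylovApprox {n : ℕ} (A : Matrix (Fin n) (Fin n) ℝ) (g v : EuclideanSpace ℝ (Fin n)) (k : ℕ)
    (t : ℝ) : EuclideanSpace ℝ (Fin n) :=
  v + WithLp.toLp 2 ((arnoldiBasis A (g - A.toEuclideanLin v) k).mulVec
    (krylovCoeff A (g - A.toEuclideanLin v) k t))

/-- The residual `r_k(t) = -A y_k(t) + g - y_k'(t)`. -/
def krylovResidual {n : ℕ} (A : Matrix (Fin n) (Fin n) ℝ) (g v : EuclideanSpace ℝ (Fin n)) (k : ℕ)
    (t : ℝ) : EuclideanSpace ℝ (Fin n) :=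
  -A.toEuclideanLin (krylovApprox A g v k t) + g - deriv (krylovApprox A g v k) t

/-- The modified Bessel function of the first kind `I_ν(x)` of integer order `ν ≥ 0`. -/
def besselI (ν : ℕ) (x : ℝ) : ℝ :=
  ∑' m : ℕ, (x / 2) ^ (2 * m + ν) / ((m ! : ℝ) * ((m + ν)! : ℝ))

/-- The power series of `I_ν` converges everywhere. -/
theorem summable_besselI (ν : ℕ) (x : ℝ) :
    Summable fun m : ℕ => (x / 2) ^ (2 * m + ν) / ((m ! : ℝ) * ((m + ν)! : ℝ)) := by
  have h := (Real.summable_pow_div_factorial ((x / 2) ^ 2)).mul_left (|x / 2| ^ ν)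
  refine Summable.of_norm_bounded h fun m => ?_
  have h1 : (1 : ℝ) ≤ ((m + ν)! : ℝ) := by exact_mod_cast Nat.one_le_iff_ne_zero.2 (by positivity)
  rw [norm_div, norm_pow, Real.norm_eq_abs, pow_add, pow_mul, sq_abs,
    Real.norm_of_nonneg (by positivity), mul_comm, mul_div_assoc]
  gcongr
  exact le_mul_of_one_le_right (by positivity) h1

end

/-! ### The scalar function $t\varphi(-tl)$ -/

noncomputable section

/-! In the Arnoldi relation only the last column leaves the Krylov space, so $r_k(t)$ is $-u_k(t)$
times the last remainder, whose norm $h_{k+1,k}$ is at most $2c$ (`krylovResidual_eq`,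
`norm_arnoldiRemainder_le`). Diagonalizing $H_k$ gives $u_k(t)=\sum_i w_i\,t\varphi(-tl_i)$, where
the $l_i\in[0,2c]$ are its eigenvalues and the $w_i$ are products of the first and last coordinates
of its eigenvectors. Hence $\sum|w_i|\le1$, and the moments of order below $k-1$ vanish because
$H_k$ is Hessenberg.

With $\mu=1-l/c\in[-1,1]$, expand $c\,e^{ct}\,t\varphi(-tl)=\sum_N\frac{(ct)^N}{N!}\sum_{j<N}\mu^j$.
Since $2\mu T_n=T_{n+1}+T_{n-1}$, the power $(2\mu)^j$ is the sum of $T_n(\mu)$ over the end points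
$n$ of all $j$-step walks on $\mathbb{Z}$. Only end points with $|n|\ge k-1$ contribute, each at
most 1 (`two_pow_mul_abs_moment_le`). Summing over $j<N$ inverts a second difference and produces
the quadratic weight (`walkSum_tailWeight`). The generating function of walks,
$e^{x(s+1/s)/2}=\sum_n I_n(x)s^n$, then yields the Bessel series (`hasSum_weighted_besselI`). -/

theorem hasSum_of_forall_eq {ι : Type*} {f g : ι → ℝ} {a b : ℝ} (h : HasSum f a)
    (hfg : ∀ i, g i = f i) (hab : b = a) : HasSum g b := by
  rw [hab, show g = f from funext hfg]
  exact h

/-- The scalar function `t φ(-t l)`, where `φ(z) = (e ^ z - 1) / z`. -/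
def scalarCoeff (l t : ℝ) : ℝ := t * ∑' j : ℕ, ((j + 1)! : ℝ)⁻¹ * (-t * l) ^ j

theorem summable_phi (z : ℝ) : Summable fun j : ℕ => ((j + 1)! : ℝ)⁻¹ * z ^ j := by
  refine Summable.of_norm_bounded (Real.summable_pow_div_factorial |z|) fun j => ?_
  rw [norm_mul, norm_pow, Real.norm_of_nonneg (by positivity), Real.norm_eq_abs, mul_comm,
    div_eq_mul_inv]
  gcongr
  omega

theorem mul_phi (z : ℝ) : z * ∑' j : ℕ, ((j + 1)! : ℝ)⁻¹ * z ^ j = Real.exp z - 1 := by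
  have h := (summable_phi z).hasSum.mul_left z
  have h2 := NormedSpace.exp_series_hasSum_exp' (𝕂 := ℝ) z
  rw [← hasSum_nat_add_iff' 1, ← Real.exp_eq_exp_ℝ] at h2
  simp only [Finset.sum_range_one, pow_zero, Nat.factorial_zero, Nat.cast_one, inv_one,
    smul_eq_mul, mul_one] at h2
  refine h.unique ?_
  exact hasSum_of_forall_eq h2 (fun j => by ring) rfl

theorem mul_scalarCoeff (l t : ℝ) : l * scalarCoeff l t = 1 - Real.exp (-t * l) := by
  have h := mul_phi (-t * l)
  unfold scalarCoeff
  linarith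

theorem scalarCoeff_zero_left (t : ℝ) : scalarCoeff 0 t = t := by
  have h : ∑' j : ℕ, ((j + 1)! : ℝ)⁻¹ * (-t * 0) ^ j = 1 := by
    rw [tsum_eq_single 0 fun j hj => by simp [hj]]
    simp
  rw [scalarCoeff, h, mul_one]

theorem hasDerivAt_scalarCoeff (l t : ℝ) :
    HasDerivAt (scalarCoeff l) (Real.exp (-t * l)) t := by
  rcases eq_or_ne l 0 with rfl | hl
  · have h : scalarCoeff 0 = id := funext scalarCoeff_zero_left
    simpa [h] using hasDerivAt_id t
  · have h : scalarCoeff l = fun t => (1 - Real.exp (-t * l)) / l := by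
      funext s
      rw [← mul_scalarCoeff, mul_div_cancel_left₀ _ hl]
    rw [h]
    have h1 : HasDerivAt (fun s : ℝ => -s * l) (-1 * l) t := (hasDerivAt_neg t).mul_const l
    have h2 := (h1.exp.const_sub 1).div_const l
    have h3 : -(Real.exp (-t * l) * (-1 * l)) / l = Real.exp (-t * l) := by
      rw [neg_one_mul, mul_neg, neg_neg, mul_div_cancel_right₀ _ hl]
    exact h3 ▸ h2

/-- For $l\ne0$ the value is $(e^{ct}-e^{ct\mu})/(1-\mu)$ with $\mu=1-l/c$, and the quotients
$(1-\mu^N)/(1-\mu)$ are geometric sums; $l=0$ is the limiting case $\mu=1$. -/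
theorem hasSum_scalarCoeff {c : ℝ} (hc : 0 < c) (l t : ℝ) :
    HasSum (fun N : ℕ => (c * t) ^ N / (N ! : ℝ) * ∑ j ∈ Finset.range N, (1 - l / c) ^ j)
      (c * Real.exp (c * t) * scalarCoeff l t) := by
  have he : ∀ z : ℝ, HasSum (fun N : ℕ => z ^ N / (N ! : ℝ)) (Real.exp z) := fun z => by
    rw [Real.exp_eq_exp_ℝ]
    exact NormedSpace.expSeries_div_hasSum_exp z
  rcases eq_or_ne l 0 with rfl | hl
  · rw [scalarCoeff_zero_left, ← hasSum_nat_add_iff' 1]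
    have h := (he (c * t)).mul_left (c * t)
    simp only [zero_div, sub_zero, one_pow, Finset.sum_const, Finset.card_range, nsmul_eq_mul,
      mul_one]
    refine hasSum_of_forall_eq h (fun N => ?_) ?_
    · rw [Nat.factorial_succ]
      push_cast
      field_simp
      ring
    · simp
      ring
  · have hl' : l / c ≠ 0 := div_ne_zero hl hc.ne'
    have h := ((he (c * t)).sub (he (c * t * (1 - l / c)))).div_const (l / c)
    refine hasSum_of_forall_eq h (fun N => ?_) ?_
    · have hgeom := geom_sum_eq (x := 1 - l / c) (by simpa using hl') N
      rw [hgeom, mul_pow (c * t), show 1 - l / c - 1 = -(l / c) by ring]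
      generalize 1 - l / c = q
      field_simp
      ring
    · have h1 : c * t * (1 - l / c) = c * t + -t * l := by field_simp; ring
      have h2 := mul_scalarCoeff l t
      rw [h1, Real.exp_add, eq_div_iff hl']
      have h3 : Real.exp (-t * l) = 1 - l * scalarCoeff l t := by linarith
      rw [h3]
      field_simp
      ring

/-! ### Walks on the integers and the quadratic weight -/

/-- The sum of `f` over the end points of all simple walks of `N` steps on `ℤ` starting
at `0`. -/
def walkSum (f : ℤ → ℝ) (N : ℕ) : ℝ :=
  ∑ p ∈ Finset.HasAntidiagonal.antidiagonal N, (N.choose p.1 : ℝ) * f ((p.2 : ℤ) - p.1)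

/-- Pascal's rule: one step of the walk is split off. -/
theorem walkSum_succ (f : ℤ → ℝ) (N : ℕ) :
    walkSum f (N + 1) = walkSum (fun n => f (n + 1) + f (n - 1)) N := by
  unfold walkSum
  rw [Finset.sum_antidiagonal_choose_succ_mul (fun i j => f ((j : ℤ) - i)),
    ← Finset.sum_add_distrib]
  refine Finset.sum_congr rfl fun p hp => ?_
  rw [Nat.choose_symm_of_eq_add (Finset.HasAntidiagonal.mem_antidiagonal.1 hp).symm]
  push_cast
  rw [← mul_add]
  congr 3 <;> ring

/-- An eigenfunction of the neighbour-sum operator is multiplied by $r$ at each step. It serves for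
the constant 1 ($r=2$) and for $n\mapsto T_n(\mu)$ ($r=2\mu$). -/
theorem walkSum_eq_pow {f : ℤ → ℝ} {r : ℝ} (h : ∀ n, f (n + 1) + f (n - 1) = r * f n) (N : ℕ) :
    walkSum f N = r ^ N * f 0 := by
  induction N with
  | zero => simp [walkSum]
  | succ N ih =>
    rw [walkSum_succ, pow_succ', mul_assoc, ← ih, walkSum, walkSum, Finset.mul_sum]
    refine Finset.sum_congr rfl fun p _ => ?_
    rw [h]
    ring

theorem walkSum_mono {f g : ℤ → ℝ} (h : ∀ n, f n ≤ g n) (N : ℕ) : walkSum f N ≤ walkSum g N :=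
  Finset.sum_le_sum fun _ _ => mul_le_mul_of_nonneg_left (h _) (by positivity)

theorem abs_walkSum_le (f : ℤ → ℝ) (N : ℕ) : |walkSum f N| ≤ walkSum (fun n => |f n|) N := by
  refine (Finset.abs_sum_le_sum_abs _ _).trans_eq (Finset.sum_congr rfl fun p _ => ?_)
  rw [abs_mul, Nat.abs_cast]

theorem walkSum_add (f g : ℤ → ℝ) (N : ℕ) :
    walkSum (fun n => f n + g n) N = walkSum f N + walkSum g N := by
  simp only [walkSum, mul_add, Finset.sum_add_distrib]

theorem walkSum_const_mul (a : ℝ) (f : ℤ → ℝ) (N : ℕ) :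
    walkSum (fun n => a * f n) N = a * walkSum f N := by
  simp only [walkSum, Finset.mul_sum, mul_left_comm]

theorem walkSum_comp_neg (f : ℤ → ℝ) (N : ℕ) : walkSum (fun n => f (-n)) N = walkSum f N := by
  unfold walkSum
  rw [← Finset.Nat.sum_antidiagonal_swap]
  refine Finset.sum_congr rfl fun p hp => ?_
  simp only [Prod.fst_swap, Prod.snd_swap, neg_sub]
  rw [Nat.choose_symm_of_eq_add (Finset.HasAntidiagonal.mem_antidiagonal.1 hp).symm]

/-- The indicator function of `{n | k ≤ n}`. -/
def tailInd (k n : ℤ) : ℝ := if k ≤ n then 1 else 0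

/-- The weight `(n - k + 2) (n - k + 1)` on `{n | k ≤ n}`. -/
def tailWeight (k n : ℤ) : ℝ := if k ≤ n then ((n : ℝ) - k + 2) * ((n : ℝ) - k + 1) else 0

theorem tailInd_nonneg (k n : ℤ) : 0 ≤ tailInd k n := by
  unfold tailInd; split_ifs <;> norm_num

theorem tailWeight_nonneg (k n : ℤ) : 0 ≤ tailWeight k n := by
  unfold tailWeight
  split_ifs with h
  · have : (k : ℝ) ≤ n := by exact_mod_cast h
    apply mul_nonneg <;> linarith
  · exact le_rfl

/-- The polynomial $(n-k+1)(n-k)$ vanishes at $n=k$ and $n=k-1$, so cutting it off below $k+1$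
leaves the second difference 2 at every $n\ge k$ and no boundary term. -/
theorem tailWeight_second_difference (k n : ℤ) :
    tailWeight (k + 1) (n + 1) + tailWeight (k + 1) (n - 1) =
      2 * tailWeight (k + 1) n + 2 * tailInd k n := by
  unfold tailWeight tailInd
  rcases lt_or_ge n k with h | h
  · rw [if_neg (by omega), if_neg (by omega), if_neg (by omega), if_neg (by omega)]
    norm_num
  · rw [if_pos (show k + 1 ≤ n + 1 by omega), if_pos h]
    rcases h.eq_or_lt with rfl | h1
    · rw [if_neg (by omega), if_neg (by omega)]
      push_cast
      ring
    · rw [if_pos (show k + 1 ≤ n by omega)]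
      rcases (show k + 1 ≤ n from h1).eq_or_lt with rfl | h2
      · rw [if_neg (by omega)]
        push_cast
        ring
      · rw [if_pos (by omega)]
        push_cast
        ring

/-- Divided by $2^N$, the second-difference identity telescopes in $N$; the initial value vanishes
because $0<k+1$. -/
theorem walkSum_tailWeight {k : ℤ} (hk : 0 ≤ k) (N : ℕ) :
    walkSum (tailWeight (k + 1)) N =
      2 ^ N * ∑ j ∈ Finset.range N, walkSum (tailInd k) j / 2 ^ j := by
  induction N with
  | zero =>
    simp only [walkSum, tailWeight]
    simp [hk]
  | succ N ih =>
    rw [walkSum_succ]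
    simp only [tailWeight_second_difference]
    rw [walkSum_add, walkSum_const_mul, walkSum_const_mul, ih, Finset.sum_range_succ]
    field_simp
    ring

theorem walkSum_tailInd_le (k : ℤ) (N : ℕ) : walkSum (tailInd k) N ≤ 2 ^ N := by
  have h := walkSum_eq_pow (f := fun _ => 1) (r := 2) (fun _ => by norm_num) N
  rw [mul_one] at h
  rw [← h]
  refine walkSum_mono (fun n => ?_) N
  unfold tailInd
  split_ifs <;> norm_num

/-- A crude bound, needed only for summability. -/
theorem walkSum_tailWeight_le {k : ℤ} (hk : 0 ≤ k) (N : ℕ) :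
    walkSum (tailWeight (k + 1)) N ≤ 4 ^ N := by
  rw [walkSum_tailWeight hk]
  have h : ∑ j ∈ Finset.range N, walkSum (tailInd k) j / 2 ^ j ≤ N := by
    refine (Finset.sum_le_card_nsmul _ _ 1 fun j _ => ?_).trans_eq (by simp)
    rw [div_le_one (by positivity)]
    exact walkSum_tailInd_le k j
  have h2 : (N : ℝ) ≤ 2 ^ N := by exact_mod_cast Nat.lt_two_pow_self.le
  calc (2 : ℝ) ^ N * _ ≤ 2 ^ N * 2 ^ N := by gcongr; exact h.trans h2
    _ = 4 ^ N := by rw [← mul_pow]; norm_num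

/-! ### Moments of signed measures with vanishing low moments -/

open Polynomial.Chebyshev in
/-- Bound for the moments of a signed measure of total variation at most one on `[-1, 1]` whose
first `k` moments vanish. -/
theorem two_pow_mul_abs_moment_le {ι : Type*} [Fintype ι] (w μ : ι → ℝ) (hw : ∑ i, |w i| ≤ 1)
    (hμ : ∀ i, |μ i| ≤ 1) (k : ℕ) (hvan : ∀ j < k, ∑ i, w i * μ i ^ j = 0) (N : ℕ) :
    2 ^ N * |∑ i, w i * μ i ^ N| ≤ 2 * walkSum (tailInd k) N := by
  set L : ℤ → ℝ := fun n => ∑ i, w i * (T ℝ n).eval (μ i) with hL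
  have hcheb : ∀ i, walkSum (fun n => (T ℝ n).eval (μ i)) N = (2 * μ i) ^ N := fun i => by
    rw [walkSum_eq_pow (r := 2 * μ i)]
    · simp
    · intro n
      rw [T_add_one]
      simp
  have h1 : 2 ^ N * ∑ i, w i * μ i ^ N = walkSum L N := by
    have : ∀ i, 2 ^ N * (w i * μ i ^ N) = w i * walkSum (fun n => (T ℝ n).eval (μ i)) N :=
      fun i => by rw [hcheb, mul_pow]; ring
    rw [Finset.mul_sum, Finset.sum_congr rfl fun i _ => this i]
    simp only [walkSum, hL, Finset.mul_sum]
    rw [Finset.sum_comm]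
    exact Finset.sum_congr rfl fun p _ => Finset.sum_congr rfl fun i _ => by ring
  -- $T_n$ has degree $|n|$, so for $|n|<k$ the vanishing moments annihilate it; otherwise
  -- $|T_n|\le1$ on $[-1,1]$ suffices.
  have h2 : ∀ n, |L n| ≤ tailInd k n + tailInd k (-n) := by
    intro n
    by_cases hn : n.natAbs < k
    · have : L n = 0 := by
        simp only [hL, Polynomial.eval_eq_sum_range, Finset.mul_sum]
        rw [Finset.sum_comm]
        refine Finset.sum_eq_zero fun j hj => ?_
        rw [natDegree_T, Finset.mem_range] at hj
        have := hvan j (by omega)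
        calc _ = (T ℝ n).coeff j * ∑ i, w i * μ i ^ j := by
              rw [Finset.mul_sum]
              exact Finset.sum_congr rfl fun i _ => by ring
          _ = 0 := by rw [this, mul_zero]
      rw [this, abs_zero]
      exact add_nonneg (tailInd_nonneg _ _) (tailInd_nonneg _ _)
    · have hle : |L n| ≤ 1 := by
        refine (Finset.abs_sum_le_sum_abs _ _).trans (le_trans (Finset.sum_le_sum fun i _ => ?_) hw)
        rw [abs_mul]
        exact mul_le_of_le_one_right (abs_nonneg _) (abs_eval_T_real_le_one n (hμ i))
      rcases le_total 0 n with h | h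
      · have h3 : tailInd k n = 1 := if_pos (by omega)
        have := tailInd_nonneg k (-n)
        linarith
      · have h3 : tailInd k (-n) = 1 := if_pos (by omega)
        have := tailInd_nonneg k n
        linarith
  calc 2 ^ N * |∑ i, w i * μ i ^ N| = |walkSum L N| := by
        rw [← h1, abs_mul, abs_of_nonneg (by positivity : (0 : ℝ) ≤ 2 ^ N)]
    _ ≤ walkSum (fun n => tailInd k n + tailInd k (-n)) N :=
        (abs_walkSum_le L N).trans (walkSum_mono h2 N)
    _ = 2 * walkSum (tailInd k) N := by
        rw [walkSum_add, walkSum_comp_neg (tailInd k)]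
        ring

/-! ### The weighted Bessel series -/

theorem summable_pow_div_factorial_mul_walkSum_tailWeight {k : ℤ} (hk : 0 ≤ k) {x : ℝ}
    (hx : 0 ≤ x) :
    Summable fun N : ℕ => (x / 2) ^ N / (N ! : ℝ) * walkSum (tailWeight (k + 1)) N := by
  refine Summable.of_nonneg_of_le (fun N => ?_) (fun N => ?_)
    (Real.summable_pow_div_factorial (2 * x))
  · refine mul_nonneg (by positivity) (Finset.sum_nonneg fun p _ => ?_)
    exact mul_nonneg (by positivity) (tailWeight_nonneg _ _)
  · calc _ ≤ (x / 2) ^ N / (N ! : ℝ) * 4 ^ N :=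
          mul_le_mul_of_nonneg_left (walkSum_tailWeight_le hk N) (by positivity)
      _ = (2 * x) ^ N / (N ! : ℝ) := by
          rw [div_mul_eq_mul_div, ← mul_pow]
          ring_nf

theorem hasSum_besselI (x : ℝ) (ν : ℕ) :
    HasSum (fun m : ℕ => (x / 2) ^ (2 * m + ν) / ((m ! : ℝ) * ((m + ν)! : ℝ))) (besselI ν x) :=
  (summable_besselI ν x).hasSum

/-- The weighted series of modified Bessel functions as a power series. -/
theorem hasSum_weighted_besselI {k : ℕ} (hk : 1 ≤ k) {x : ℝ} (hx : 0 ≤ x) :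
    HasSum (fun ν : {ν : ℕ // k ≤ ν} =>
        ((ν.1 : ℝ) - k + 2) * ((ν.1 : ℝ) - k + 1) * besselI ν.1 x)
      (∑' N : ℕ, (x / 2) ^ N / (N ! : ℝ) * walkSum (tailWeight k) N) := by
  obtain ⟨k', rfl⟩ : ∃ k', k = k' + 1 := ⟨k - 1, by omega⟩
  set k := k' + 1
  -- The double series of $e^{xs/2}e^{x/(2s)}$, with $s^n$ replaced by the weight at $n$. Grouping
  -- by `p.1 + p.2` gives walk sums, grouping by `p.2 - p.1` gives Bessel functions; all terms are
  -- nonnegative.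
  set F : ℕ × ℕ → ℝ := fun p =>
    (x / 2) ^ (p.1 + p.2) / ((p.1 ! : ℝ) * (p.2 ! : ℝ)) * tailWeight k ((p.2 : ℤ) - p.1) with hF
  have hF0 : ∀ p, 0 ≤ F p := fun p => mul_nonneg (by positivity) (tailWeight_nonneg _ _)
  have hfib : ∀ N : ℕ, ∑ p ∈ Finset.HasAntidiagonal.antidiagonal N, F p =
      (x / 2) ^ N / (N ! : ℝ) * walkSum (tailWeight k) N := by
    intro N
    rw [walkSum, Finset.mul_sum]
    refine Finset.sum_congr rfl fun p hp => ?_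
    rw [Finset.HasAntidiagonal.mem_antidiagonal] at hp
    subst hp
    have h := Nat.add_choose_mul_factorial_mul_factorial p.1 p.2
    have h' : ((p.1 + p.2).choose p.1 : ℝ) * (p.1 ! : ℝ) * (p.2 ! : ℝ) = ((p.1 + p.2)! : ℝ) := by
      rw [Nat.choose_symm_add]
      exact_mod_cast h
    have h0 : ((p.1 + p.2).choose p.1 : ℝ) ≠ 0 := by
      exact_mod_cast (Nat.choose_pos (Nat.le_add_right _ _)).ne'
    simp only [hF]
    rw [← h']
    field_simp
  have hsum : Summable fun N : ℕ => (x / 2) ^ N / (N ! : ℝ) * walkSum (tailWeight k) N :=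
    summable_pow_div_factorial_mul_walkSum_tailWeight (k := (k' : ℤ)) (by positivity) hx
  have hsig : HasSum (fun q : Σ N : ℕ, Finset.HasAntidiagonal.antidiagonal N => F q.2)
      (∑' N : ℕ, (x / 2) ^ N / (N ! : ℝ) * walkSum (tailWeight k) N) := by
    have hfib' : ∀ N : ℕ, HasSum (fun p : Finset.HasAntidiagonal.antidiagonal N => F p)
        ((x / 2) ^ N / (N ! : ℝ) * walkSum (tailWeight k) N) := fun N => by
      rw [← hfib, ← Finset.sum_coe_sort]
      exact hasSum_fintype _
    have hs : Summable (fun q : Σ N : ℕ, Finset.HasAntidiagonal.antidiagonal N => F q.2) := by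
      rw [summable_sigma_of_nonneg fun q => hF0 _]
      refine ⟨fun N => (hfib' N).summable, ?_⟩
      simpa only [(hfib' _).tsum_eq] using hsum
    rw [(hs.hasSum.sigma hfib').tsum_eq]
    exact hs.hasSum
  have hprod : HasSum F (∑' N : ℕ, (x / 2) ^ N / (N ! : ℝ) * walkSum (tailWeight k) N) := by
    rw [← Finset.HasAntidiagonal.sigmaAntidiagonalEquivProd.hasSum_iff]
    exact hsig
  -- Parametrizes exactly the pairs with difference $\nu\ge k$, outside which the weight is zero.
  let e : {ν : ℕ // k ≤ ν} × ℕ → ℕ × ℕ := fun q => (q.2, q.2 + q.1.1)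
  have he : Function.Injective e := by
    rintro ⟨⟨a, ha⟩, m⟩ ⟨⟨b, hb⟩, m'⟩ h
    simp only [e, Prod.mk.injEq] at h ⊢
    refine ⟨Subtype.ext ?_, h.1⟩
    simp only
    omega
  have hsupp : ∀ p, p ∉ Set.range e → F p = 0 := by
    intro p hp
    have : ¬ ((k : ℤ) ≤ (p.2 : ℤ) - p.1) := fun h => hp
      ⟨(⟨p.2 - p.1, by omega⟩, p.1), by ext <;> simp only [e]; omega⟩
    simp only [hF, tailWeight]
    rw [if_neg this, mul_zero]
  have hcomp := (he.hasSum_iff hsupp).2 hprod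
  refine hcomp.prod_fiberwise fun ν => ?_
  refine hasSum_of_forall_eq ((hasSum_besselI x ν.1).mul_left
    (((ν.1 : ℝ) - k + 2) * ((ν.1 : ℝ) - k + 1))) (fun m => ?_) rfl
  have hν := ν.2
  simp only [Function.comp, hF, e, tailWeight]
  rw [if_pos (by push_cast; omega), show m + (m + ν.1) = 2 * m + ν.1 by ring]
  push_cast
  ring

/-- If a signed measure of total variation at most one on `[0, 2 c]` has `k - 1` vanishing moments,
its integral of `l ↦ t φ(-t l)` is bounded by a series of modified Bessel functions. -/
theorem abs_sum_mul_scalarCoeff_le {ι : Type*} [Fintype ι] (w l : ι → ℝ) (hw : ∑ i, |w i| ≤ 1)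
    {c : ℝ} (hc : 0 < c) (hl : ∀ i, l i ∈ Set.Icc 0 (2 * c)) {k : ℕ} (hk : 1 ≤ k)
    (hvan : ∀ j < k - 1, ∑ i, w i * l i ^ j = 0) {t : ℝ} (ht : 0 ≤ t) :
    c * |∑ i, w i * scalarCoeff (l i) t| ≤ 2 * Real.exp (-(c * t)) *
      ∑' ν : {ν : ℕ // k ≤ ν},
        ((ν.1 : ℝ) - k + 2) * ((ν.1 : ℝ) - k + 1) * besselI ν.1 (c * t) := by
  rw [(hasSum_weighted_besselI hk (mul_nonneg hc.le ht)).tsum_eq]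
  obtain ⟨k', rfl⟩ : ∃ k', k = k' + 1 := ⟨k - 1, by omega⟩
  rw [Nat.add_sub_cancel] at hvan
  set x := c * t with hx
  have hx0 : 0 ≤ x := mul_nonneg hc.le ht
  set μ : ι → ℝ := fun i => 1 - l i / c with hμdef
  have hμ : ∀ i, |μ i| ≤ 1 := fun i => by
    obtain ⟨h0, h1⟩ := hl i
    have h2 : l i / c ≤ 2 := by rw [div_le_iff₀ hc]; exact h1
    have h3 : 0 ≤ l i / c := by positivity
    rw [abs_le]
    constructor <;> simp only [hμdef] <;> linarith
  -- An affine change of variable does not raise the degree.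
  have hvan' : ∀ j < k', ∑ i, w i * μ i ^ j = 0 := by
    intro j hj
    have hexp : ∀ i, w i * μ i ^ j =
        ∑ m ∈ Finset.range (j + 1), (-1 / c) ^ m * (j.choose m : ℝ) * (w i * l i ^ m) := fun i => by
      rw [hμdef]
      simp only
      rw [show 1 - l i / c = (-1 / c) * l i + 1 by ring, add_pow, Finset.mul_sum]
      refine Finset.sum_congr rfl fun m _ => ?_
      rw [one_pow, mul_pow]
      ring
    rw [Finset.sum_congr rfl fun i _ => hexp i, Finset.sum_comm]
    refine Finset.sum_eq_zero fun m hm => ?_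
    rw [Finset.mem_range] at hm
    rw [← Finset.mul_sum, hvan m (by omega), mul_zero]
  have hmom := two_pow_mul_abs_moment_le w μ hw hμ k' hvan'
  have hs : HasSum (fun N : ℕ => x ^ N / (N ! : ℝ) *
        ∑ j ∈ Finset.range N, ∑ i, w i * μ i ^ j)
      (c * Real.exp x * ∑ i, w i * scalarCoeff (l i) t) := by
    have h := hasSum_sum (s := Finset.univ) fun i _ =>
      (hasSum_scalarCoeff hc (l i) t).mul_left (w i)
    refine hasSum_of_forall_eq h (fun N => ?_) ?_
    · rw [Finset.sum_comm, Finset.mul_sum]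
      refine Finset.sum_congr rfl fun i _ => ?_
      rw [← Finset.mul_sum]
      ring
    · rw [Finset.mul_sum]
      exact Finset.sum_congr rfl fun i _ => by ring
  -- The factor 2 comes from the two tails in the moment bound.
  have hb := (summable_pow_div_factorial_mul_walkSum_tailWeight (k := (k' : ℤ)) (by positivity)
    hx0).hasSum.mul_left 2
  have hle : ‖c * Real.exp x * ∑ i, w i * scalarCoeff (l i) t‖ ≤ _ :=
    hs.norm_le_of_bounded hb fun N => by
      rw [norm_mul, Real.norm_of_nonneg (by positivity), walkSum_tailWeight (by positivity),
        Real.norm_eq_abs]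
      calc _ ≤ x ^ N / (N ! : ℝ) *
            ∑ j ∈ Finset.range N, 2 * (walkSum (tailInd k') j / 2 ^ j) := by
            gcongr
            refine (Finset.abs_sum_le_sum_abs _ _).trans (Finset.sum_le_sum fun j _ => ?_)
            rw [← mul_div_assoc, le_div_iff₀ (by positivity), mul_comm]
            exact hmom j
        _ = _ := by
            rw [← Finset.mul_sum, div_pow]
            field_simp
  rw [Real.norm_eq_abs, abs_mul, abs_of_nonneg (by positivity : 0 ≤ c * Real.exp x)] at hle
  rw [Real.exp_neg]
  have hpos := Real.exp_pos x
  push_cast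
  rw [mul_right_comm, ← div_eq_mul_inv, le_div_iff₀ hpos]
  linarith

/-! ### Spectral decomposition of symmetric matrices -/

section Symmetric

variable {n : ℕ} {A : Matrix (Fin n) (Fin n) ℝ}

theorem inner_toEuclideanLin_comm (hA : A.IsSymm) (x y : EuclideanSpace ℝ (Fin n)) :
    inner ℝ (A.toEuclideanLin x) y = inner ℝ x (A.toEuclideanLin y) :=
  Matrix.isSymmetric_toEuclideanLin_iff.2 (show A.IsHermitian from hA) x y

theorem toEuclideanLin_eigenvectorBasis (hA : A.IsHermitian) (i : Fin n) :
    A.toEuclideanLin (hA.eigenvectorBasis i) = hA.eigenvalues i • hA.eigenvectorBasis i := by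
  rw [Matrix.toLpLin_apply, hA.mulVec_eigenvectorBasis]
  rfl

theorem inner_eigenvectorBasis_toEuclideanLin (hA : A.IsHermitian) (i : Fin n)
    (x : EuclideanSpace ℝ (Fin n)) :
    inner ℝ (hA.eigenvectorBasis i) (A.toEuclideanLin x) =
      hA.eigenvalues i * inner ℝ (hA.eigenvectorBasis i) x := by
  rw [← inner_toEuclideanLin_comm (show A.IsSymm from hA), toEuclideanLin_eigenvectorBasis, real_inner_smul_left]

theorem inner_toEuclideanLin_self_mem_Icc (hA : A.IsSymm) {b : ℝ}
    (hspec : spectrum ℝ A ⊆ Set.Icc 0 b) (x : EuclideanSpace ℝ (Fin n)) :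
    inner ℝ x (A.toEuclideanLin x) ∈ Set.Icc 0 (b * ‖x‖ ^ 2) := by
  have hH : A.IsHermitian := hA
  have hev := fun i => hspec (hH.eigenvalues_mem_spectrum_real i)
  have h : inner ℝ x (A.toEuclideanLin x) =
      ∑ i, hH.eigenvalues i * inner ℝ (hH.eigenvectorBasis i) x ^ 2 := by
    rw [← hH.eigenvectorBasis.sum_inner_mul_inner]
    refine Finset.sum_congr rfl fun i _ => ?_
    rw [inner_eigenvectorBasis_toEuclideanLin, real_inner_comm]
    ring
  rw [h, ← hH.eigenvectorBasis.sum_sq_inner_right, Finset.mul_sum]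
  exact ⟨Finset.sum_nonneg fun i _ => mul_nonneg (hev i).1 (sq_nonneg _),
    Finset.sum_le_sum fun i _ => mul_le_mul_of_nonneg_right (hev i).2 (sq_nonneg _)⟩

theorem norm_toEuclideanLin_le (hA : A.IsSymm) {b : ℝ} (hb : 0 ≤ b)
    (hspec : spectrum ℝ A ⊆ Set.Icc 0 b) (x : EuclideanSpace ℝ (Fin n)) :
    ‖A.toEuclideanLin x‖ ≤ b * ‖x‖ := by
  have hH : A.IsHermitian := hA
  have hev := fun i => hspec (hH.eigenvalues_mem_spectrum_real i)
  refine le_of_sq_le_sq ?_ (by positivity)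
  rw [mul_pow, ← hH.eigenvectorBasis.sum_sq_inner_right, ← hH.eigenvectorBasis.sum_sq_inner_right,
    Finset.mul_sum]
  refine Finset.sum_le_sum fun i _ => ?_
  rw [inner_eigenvectorBasis_toEuclideanLin, mul_pow]
  gcongr
  · exact (hev i).1
  · exact (hev i).2

/-- Completeness of the eigenvector basis in coordinates. -/
theorem sum_eigenvectorBasis_mul (hA : A.IsHermitian) (j l : Fin n) :
    ∑ i, hA.eigenvectorBasis i j * hA.eigenvectorBasis i l = if j = l then 1 else 0 := by
  have h := hA.eigenvectorBasis.sum_inner_mul_inner (EuclideanSpace.single j (1 : ℝ))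
    (EuclideanSpace.single l (1 : ℝ))
  simpa [EuclideanSpace.inner_single_left, EuclideanSpace.inner_single_right, Pi.single_apply, eq_comm]
    using h

/-- Presents entries of powers as moments of a signed measure on the eigenvalues, so that zero
entries become vanishing moments. -/
theorem pow_apply_eq_sum (hA : A.IsHermitian) (m : ℕ) (j l : Fin n) :
    (A ^ m) j l = ∑ i, hA.eigenvectorBasis i l * hA.eigenvectorBasis i j *
      hA.eigenvalues i ^ m := by
  induction m generalizing j with
  | zero =>
    simp only [pow_zero, mul_one, sum_eigenvectorBasis_mul, Matrix.one_apply, eq_comm]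
  | succ m ih =>
    rw [pow_succ', Matrix.mul_apply]
    simp only [ih, Finset.mul_sum]
    rw [Finset.sum_comm]
    refine Finset.sum_congr rfl fun i _ => ?_
    have h := congrFun (hA.mulVec_eigenvectorBasis i) j
    simp only [Matrix.mulVec, dotProduct, Pi.smul_apply, smul_eq_mul] at h
    rw [pow_succ', ← mul_assoc, mul_assoc (hA.eigenvectorBasis i l),
      mul_comm _ (hA.eigenvalues i), ← h, Finset.mul_sum, Finset.sum_mul]
    exact Finset.sum_congr rfl fun _ _ => by ring

theorem phiMatrix_apply_eq_sum (hA : A.IsHermitian) (t : ℝ) (j l : Fin n) :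
    t * phiMatrix ((-t) • A) j l = ∑ i, hA.eigenvectorBasis i l * hA.eigenvectorBasis i j *
      scalarCoeff (hA.eigenvalues i) t := by
  have h1 : HasSum (fun m : ℕ => ((m + 1)! : ℝ)⁻¹ * (((-t) • A) ^ m) j l)
      (phiMatrix ((-t) • A) j l) :=
    Pi.hasSum.1 (Pi.hasSum.1 (summable_phiMatrix ((-t) • A)).hasSum j) l
  have h2 := hasSum_sum (s := Finset.univ) fun i _ =>
    (summable_phi (-t * hA.eigenvalues i)).hasSum.mul_left
      (hA.eigenvectorBasis i l * hA.eigenvectorBasis i j)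
  have h3 : (fun m : ℕ => ((m + 1)! : ℝ)⁻¹ * (((-t) • A) ^ m) j l) = fun m =>
      ∑ i, hA.eigenvectorBasis i l * hA.eigenvectorBasis i j *
        (((m + 1)! : ℝ)⁻¹ * (-t * hA.eigenvalues i) ^ m) := by
    funext m
    rw [smul_pow, Matrix.smul_apply, pow_apply_eq_sum hA, smul_eq_mul, Finset.mul_sum,
      Finset.mul_sum]
    refine Finset.sum_congr rfl fun i _ => ?_
    rw [mul_pow]
    ring
  rw [h3] at h1
  rw [h1.unique h2, Finset.mul_sum]
  refine Finset.sum_congr rfl fun i _ => ?_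
  rw [scalarCoeff]
  ring

end Symmetric

/-! ### The Arnoldi process, including breakdown -/

section Arnoldi

variable {n : ℕ} (A : Matrix (Fin n) (Fin n) ℝ) (g : EuclideanSpace ℝ (Fin n))

/-- The vector `A v_j - ∑_{i ≤ j} (v_iᵀ A v_j) v_i` whose normalization is the next
Arnoldi vector. -/
def arnoldiRemainder (j : ℕ) : EuclideanSpace ℝ (Fin n) :=
  A.toEuclideanLin (arnoldiVec A g j) - ∑ i ∈ Finset.range (j + 1),
    inner ℝ (arnoldiVec A g i) (A.toEuclideanLin (arnoldiVec A g j)) • arnoldiVec A g i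

theorem arnoldiVec_zero : arnoldiVec A g 0 = ‖g‖⁻¹ • g := by
  rw [arnoldiVec]

theorem arnoldiVec_succ (j : ℕ) :
    arnoldiVec A g (j + 1) = ‖arnoldiRemainder A g j‖⁻¹ • arnoldiRemainder A g j := by
  rw [arnoldiVec, arnoldiRemainder, Finset.sum_range]

theorem norm_smul_arnoldiVec_succ (j : ℕ) :
    ‖arnoldiRemainder A g j‖ • arnoldiVec A g (j + 1) = arnoldiRemainder A g j := by
  rw [arnoldiVec_succ, smul_smul]
  rcases eq_or_ne (arnoldiRemainder A g j) 0 with h | h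
  · rw [h, smul_zero]
  · rw [mul_inv_cancel₀ (norm_ne_zero_iff.2 h), one_smul]

theorem norm_inv_smul_eq_one_or_eq_zero {E : Type*} [NormedAddCommGroup E] [NormedSpace ℝ E]
    (x : E) : ‖‖x‖⁻¹ • x‖ = 1 ∨ ‖x‖⁻¹ • x = 0 := by
  rcases eq_or_ne x 0 with rfl | h
  · right
    rw [smul_zero]
  · left
    rw [norm_smul, norm_inv, norm_norm, inv_mul_cancel₀ (norm_ne_zero_iff.2 h)]

theorem norm_arnoldiVec_eq_one_or_eq_zero (j : ℕ) :
    ‖arnoldiVec A g j‖ = 1 ∨ arnoldiVec A g j = 0 := by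
  cases j with
  | zero => rw [arnoldiVec_zero]; exact norm_inv_smul_eq_one_or_eq_zero g
  | succ j => rw [arnoldiVec_succ]; exact norm_inv_smul_eq_one_or_eq_zero _

theorem norm_arnoldiVec_le_one (j : ℕ) : ‖arnoldiVec A g j‖ ≤ 1 := by
  rcases norm_arnoldiVec_eq_one_or_eq_zero A g j with h | h
  · exact h.le
  · rw [h, norm_zero]
    exact zero_le_one

theorem inner_arnoldiVec_of_lt {i j : ℕ} (hij : i < j) :
    inner ℝ (arnoldiVec A g i) (arnoldiVec A g j) = 0 := by
  induction j using Nat.strong_induction_on generalizing i with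
  | _ j ih =>
    obtain ⟨j, rfl⟩ : ∃ m, j = m + 1 := ⟨j - 1, by omega⟩
    suffices h : inner ℝ (arnoldiVec A g i) (arnoldiRemainder A g j) = 0 by
      rw [arnoldiVec_succ, real_inner_smul_right, h, mul_zero]
    rw [arnoldiRemainder, inner_sub_right, inner_sum, Finset.sum_eq_single i]
    -- After a breakdown $v_i$ may be zero; then both terms vanish instead of cancelling.
    · rw [real_inner_smul_right, real_inner_self_eq_norm_sq]
      rcases norm_arnoldiVec_eq_one_or_eq_zero A g i with h | h
      · rw [h]
        ring
      · rw [h]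
        simp
    · intro l hl hli
      rw [Finset.mem_range] at hl
      rw [real_inner_smul_right]
      rcases lt_or_gt_of_ne hli with h | h
      · rw [real_inner_comm (arnoldiVec A g l) (arnoldiVec A g i), ih i hij h, mul_zero]
      · rw [ih l hl h, mul_zero]
    · intro h
      exact absurd (Finset.mem_range.2 hij) h

theorem inner_arnoldiVec_of_ne {i j : ℕ} (hij : i ≠ j) :
    inner ℝ (arnoldiVec A g i) (arnoldiVec A g j) = 0 := by
  rcases lt_or_gt_of_ne hij with h | h
  · exact inner_arnoldiVec_of_lt A g h
  · rw [real_inner_comm]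
    exact inner_arnoldiVec_of_lt A g h

theorem toEuclideanLin_arnoldiVec (j : ℕ) :
    A.toEuclideanLin (arnoldiVec A g j) = ∑ i ∈ Finset.range (j + 1),
      inner ℝ (arnoldiVec A g i) (A.toEuclideanLin (arnoldiVec A g j)) • arnoldiVec A g i +
        ‖arnoldiRemainder A g j‖ • arnoldiVec A g (j + 1) := by
  rw [norm_smul_arnoldiVec_succ, arnoldiRemainder, add_sub_cancel]

theorem inner_arnoldiVec_toEuclideanLin_of_le {i j : ℕ} (hij : j + 1 ≤ i) :
    inner ℝ (arnoldiVec A g i) (A.toEuclideanLin (arnoldiVec A g j)) =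
      ‖arnoldiRemainder A g j‖ * inner ℝ (arnoldiVec A g i) (arnoldiVec A g (j + 1)) := by
  rw [toEuclideanLin_arnoldiVec, inner_add_right, inner_sum, Finset.sum_eq_zero, zero_add,
    real_inner_smul_right]
  intro l hl
  rw [Finset.mem_range] at hl
  rw [real_inner_smul_right, inner_arnoldiVec_of_ne A g (by omega), mul_zero]

theorem inner_arnoldiVec_succ_toEuclideanLin (j : ℕ) :
    inner ℝ (arnoldiVec A g (j + 1)) (A.toEuclideanLin (arnoldiVec A g j)) =
      ‖arnoldiRemainder A g j‖ := by
  rw [inner_arnoldiVec_toEuclideanLin_of_le A g le_rfl, real_inner_self_eq_norm_sq]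
  rcases norm_arnoldiVec_eq_one_or_eq_zero A g (j + 1) with h | h
  · rw [h, one_pow, mul_one]
  · have h1 := norm_smul_arnoldiVec_succ A g j
    rw [h, smul_zero] at h1
    rw [← h1, norm_zero, zero_mul]

theorem norm_arnoldiRemainder_le (hA : A.IsSymm) {b : ℝ} (hb : 0 ≤ b)
    (hspec : spectrum ℝ A ⊆ Set.Icc 0 b) (j : ℕ) : ‖arnoldiRemainder A g j‖ ≤ b := by
  rw [← inner_arnoldiVec_succ_toEuclideanLin]
  calc _ ≤ ‖arnoldiVec A g (j + 1)‖ * ‖A.toEuclideanLin (arnoldiVec A g j)‖ :=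
        real_inner_le_norm _ _
    _ ≤ 1 * (b * 1) := by
        gcongr
        · exact norm_arnoldiVec_le_one A g _
        · exact (norm_toEuclideanLin_le hA hb hspec _).trans
            (by gcongr; exact norm_arnoldiVec_le_one A g _)
    _ = b := by ring

/-- $Av_j$ lies in the span of the vectors up to index $j+1$, so every column but the last is
reproduced by projecting onto the first $k$ vectors. -/
theorem sub_sum_range_eq_zero {j k : ℕ} (hjk : j + 1 < k) :
    A.toEuclideanLin (arnoldiVec A g j) - ∑ i ∈ Finset.range k,
      inner ℝ (arnoldiVec A g i) (A.toEuclideanLin (arnoldiVec A g j)) • arnoldiVec A g i = 0 := by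
  rw [sub_eq_zero]
  have hsub : Finset.range (j + 1 + 1) ⊆ Finset.range k := Finset.range_subset_range.2 hjk
  rw [← Finset.sum_subset hsub, Finset.sum_range_succ _ (j + 1),
    inner_arnoldiVec_succ_toEuclideanLin]
  · exact toEuclideanLin_arnoldiVec A g j
  · intro i _ hi
    rw [Finset.mem_range, not_lt] at hi
    rw [inner_arnoldiVec_toEuclideanLin_of_le A g (by omega),
      inner_arnoldiVec_of_ne A g (by omega), mul_zero, zero_smul]

theorem toLp_arnoldiBasis_mulVec (k : ℕ) (x : Fin k → ℝ) :
    WithLp.toLp 2 ((arnoldiBasis A g k).mulVec x) = ∑ j : Fin k, x j • arnoldiVec A g j := by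
  ext i
  simp [arnoldiBasis, Matrix.mulVec, dotProduct, mul_comm]

theorem arnoldiHess_apply (k : ℕ) (i j : Fin k) :
    arnoldiHess A g k i j =
      inner ℝ (arnoldiVec A g i) (A.toEuclideanLin (arnoldiVec A g j)) := by
  rw [arnoldiHess, Matrix.mul_assoc, Matrix.mul_apply, PiLp.inner_apply]
  refine Finset.sum_congr rfl fun l _ => ?_
  simp only [Matrix.transpose_apply, arnoldiBasis, Matrix.of_apply, Matrix.toLpLin_apply,
    Matrix.mul_apply, Matrix.mulVec, dotProduct, RCLike.inner_apply, conj_trivial]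
  ring

variable {A} in
theorem isHermitian_arnoldiHess (hA : A.IsSymm) (k : ℕ) : (arnoldiHess A g k).IsHermitian := by
  ext i j
  rw [Matrix.conjTranspose_apply, star_trivial, arnoldiHess_apply, arnoldiHess_apply,
    ← inner_toEuclideanLin_comm hA, real_inner_comm]

/-- Each factor of a Hessenberg matrix moves the support of $e_1$ down by at most one row. -/
theorem arnoldiHess_pow_apply_zero {k : ℕ} (hk : 0 < k) (m : ℕ) (i : Fin k) (hi : m < (i : ℕ)) :
    (arnoldiHess A g k ^ m) i ⟨0, hk⟩ = 0 := by
  induction m generalizing i with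
  | zero =>
    rw [pow_zero, Matrix.one_apply_ne]
    exact fun h => hi.ne' (congrArg Fin.val h)
  | succ m ih =>
    rw [pow_succ', Matrix.mul_apply]
    refine Finset.sum_eq_zero fun l _ => ?_
    rcases lt_or_ge m (l : ℕ) with h | h
    · rw [ih l h, mul_zero]
    · rw [arnoldiHess_apply, inner_arnoldiVec_toEuclideanLin_of_le A g (by omega),
        inner_arnoldiVec_of_ne A g (by omega), mul_zero, zero_mul]

/-- Only a contraction, not an isometry, since some $v_j$ may be zero. -/
theorem norm_sum_smul_arnoldiVec_sq_le {k : ℕ} (x : EuclideanSpace ℝ (Fin k)) :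
    ‖∑ j : Fin k, x j • arnoldiVec A g j‖ ^ 2 ≤ ‖x‖ ^ 2 := by
  rw [← real_inner_self_eq_norm_sq, sum_inner, EuclideanSpace.real_norm_sq_eq]
  refine Finset.sum_le_sum fun j _ => ?_
  rw [inner_sum, Finset.sum_eq_single j]
  · rw [real_inner_smul_left, real_inner_smul_right, real_inner_self_eq_norm_sq]
    have h : ‖arnoldiVec A g j‖ ^ 2 ≤ 1 := pow_le_one₀ (norm_nonneg _)
      (norm_arnoldiVec_le_one A g j)
    nlinarith [mul_le_mul_of_nonneg_left h (sq_nonneg (x j))]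
  · intro l _ hl
    rw [real_inner_smul_left, real_inner_smul_right,
      inner_arnoldiVec_of_ne A g (fun h => hl (Fin.ext h.symm)), mul_zero, mul_zero]
  · intro h
    exact absurd (Finset.mem_univ j) h

variable {A} in
-- For a unit eigenvector $x$ the eigenvalue is the Rayleigh quotient $x^TH_kx=y^TAy$ with $y=V_kx$,
-- $\|y\|\le1$.
theorem eigenvalues_arnoldiHess_mem_Icc (hA : A.IsSymm) {b : ℝ} (hb : 0 ≤ b)
    (hspec : spectrum ℝ A ⊆ Set.Icc 0 b) (k : ℕ) (i : Fin k) :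
    (isHermitian_arnoldiHess g hA k).eigenvalues i ∈ Set.Icc 0 b := by
  set hH := isHermitian_arnoldiHess g hA k
  set x := hH.eigenvectorBasis i with hx
  have hx1 : ‖x‖ = 1 := hH.eigenvectorBasis.norm_eq_one i
  set y := ∑ j : Fin k, x j • arnoldiVec A g j with hy
  have h1 : hH.eigenvalues i = inner ℝ x ((arnoldiHess A g k).toEuclideanLin x) := by
    rw [hx, toEuclideanLin_eigenvectorBasis, real_inner_smul_right, ← hx,
      real_inner_self_eq_norm_sq, hx1]
    ring
  have h2 : inner ℝ x ((arnoldiHess A g k).toEuclideanLin x) =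
      inner ℝ y (A.toEuclideanLin y) := by
    rw [PiLp.inner_apply, hy, map_sum, sum_inner]
    refine Finset.sum_congr rfl fun j _ => ?_
    simp only [Matrix.toLpLin_apply, Matrix.mulVec, dotProduct, RCLike.inner_apply, conj_trivial,
      inner_sum, map_smul, real_inner_smul_left, real_inner_smul_right, arnoldiHess_apply,
      Finset.sum_mul]
    exact Finset.sum_congr rfl fun l _ => by ring
  have h3 := inner_toEuclideanLin_self_mem_Icc hA hspec y
  rw [h1, h2]
  refine ⟨h3.1, h3.2.trans ?_⟩
  have h4 : ‖y‖ ^ 2 ≤ 1 := by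
    have := norm_sum_smul_arnoldiVec_sq_le A g x
    rwa [hx1, one_pow] at this
  nlinarith

end Arnoldi

/-! ### The Krylov approximation and its residual -/

section Krylov

variable {n : ℕ} {A : Matrix (Fin n) (Fin n) ℝ}

theorem krylovCoeff_apply (hA : A.IsSymm) {g : EuclideanSpace ℝ (Fin n)} (hg : ‖g‖ = 1) {k : ℕ}
    (hk : 0 < k) (t : ℝ) (j : Fin k) :
    krylovCoeff A g k t j =
      ∑ i, (isHermitian_arnoldiHess g hA k).eigenvectorBasis i ⟨0, hk⟩ *
        (isHermitian_arnoldiHess g hA k).eigenvectorBasis i j *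
        scalarCoeff ((isHermitian_arnoldiHess g hA k).eigenvalues i) t := by
  rw [← phiMatrix_apply_eq_sum, krylovCoeff, hg, one_smul, Pi.smul_apply, smul_eq_mul]
  congr 1
  rw [Matrix.mulVec, dotProduct, Finset.sum_eq_single ⟨0, hk⟩]
  · rw [if_pos rfl, mul_one]
  · intro l _ hl
    rw [if_neg fun h => hl (Fin.ext h), mul_zero]
  · intro h
    exact absurd (Finset.mem_univ _) h

/-- The vector `u` of coefficients solves `u' = -H u + e₁`. -/
theorem hasDerivAt_krylovCoeff (hA : A.IsSymm) {g : EuclideanSpace ℝ (Fin n)} (hg : ‖g‖ = 1)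
    {k : ℕ} (hk : 0 < k) (t : ℝ) (j : Fin k) :
    HasDerivAt (fun s => krylovCoeff A g k s j)
      ((if (⟨0, hk⟩ : Fin k) = j then 1 else 0) -
        ∑ l, arnoldiHess A g k j l * krylovCoeff A g k t l) t := by
  set hH := isHermitian_arnoldiHess g hA k with hHdef
  have h1 : HasDerivAt (fun s => krylovCoeff A g k s j)
      (∑ i, hH.eigenvectorBasis i ⟨0, hk⟩ * hH.eigenvectorBasis i j *
        Real.exp (-t * hH.eigenvalues i)) t := by
    simp only [krylovCoeff_apply hA hg hk]
    exact HasDerivAt.fun_sum fun i _ => (hasDerivAt_scalarCoeff _ t).const_mul _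
  have h2 : ∑ l, arnoldiHess A g k j l * krylovCoeff A g k t l =
      ∑ i, hH.eigenvectorBasis i ⟨0, hk⟩ * hH.eigenvectorBasis i j *
        (hH.eigenvalues i * scalarCoeff (hH.eigenvalues i) t) := by
    simp only [krylovCoeff_apply hA hg hk, Finset.mul_sum]
    rw [Finset.sum_comm]
    refine Finset.sum_congr rfl fun i _ => ?_
    have h := congrFun (hH.mulVec_eigenvectorBasis i) j
    simp only [Matrix.mulVec, dotProduct, Pi.smul_apply, smul_eq_mul] at h
    calc _ = hH.eigenvectorBasis i ⟨0, hk⟩ * scalarCoeff (hH.eigenvalues i) t *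
          ∑ l, arnoldiHess A g k j l * hH.eigenvectorBasis i l := by
          rw [Finset.mul_sum]
          exact Finset.sum_congr rfl fun l _ => by ring
      _ = _ := by
          rw [h]
          ring
  -- Expanding $e_1$ in the eigenbasis reduces the equation to $1-l\,t\varphi(-tl)=e^{-tl}$ at each
  -- eigenvalue.
  rw [h2, ← sum_eigenvectorBasis_mul hH, ← Finset.sum_sub_distrib]
  convert h1 using 2 with i
  rw [mul_scalarCoeff]
  ring

theorem hasDerivAt_krylovApprox (hA : A.IsSymm) {g v : EuclideanSpace ℝ (Fin n)}
    (hg : ‖g - A.toEuclideanLin v‖ = 1) {k : ℕ} (hk : 0 < k) (t : ℝ) :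
    HasDerivAt (krylovApprox A g v k)
      (∑ j : Fin k, ((if (⟨0, hk⟩ : Fin k) = j then 1 else 0) -
        ∑ l, arnoldiHess A (g - A.toEuclideanLin v) k j l *
          krylovCoeff A (g - A.toEuclideanLin v) k t l) •
        arnoldiVec A (g - A.toEuclideanLin v) j) t := by
  have h : krylovApprox A g v k = fun s => v + ∑ j : Fin k,
      krylovCoeff A (g - A.toEuclideanLin v) k s j •
        arnoldiVec A (g - A.toEuclideanLin v) j := by
    funext s
    rw [krylovApprox, toLp_arnoldiBasis_mulVec]
  rw [h]
  exact (HasDerivAt.fun_sum fun j _ =>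
    (hasDerivAt_krylovCoeff hA hg hk t j).smul_const _).const_add v

/-- The residual is a multiple of the last remainder of the Arnoldi process. -/
theorem krylovResidual_eq (hA : A.IsSymm) {g v : EuclideanSpace ℝ (Fin n)}
    (hg : ‖g - A.toEuclideanLin v‖ = 1) (k : ℕ) (t : ℝ) :
    krylovResidual A g v (k + 1) t =
      -krylovCoeff A (g - A.toEuclideanLin v) (k + 1) t (Fin.last k) •
        arnoldiRemainder A (g - A.toEuclideanLin v) k := by
  rw [krylovResidual, (hasDerivAt_krylovApprox hA hg k.succ_pos t).deriv, krylovApprox,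
    toLp_arnoldiBasis_mulVec]
  set w := g - A.toEuclideanLin v with hw
  set u := krylovCoeff A w (k + 1) t
  have h0 : arnoldiVec A w 0 = w := by rw [arnoldiVec_zero, hg, inv_one, one_smul]
  have h1 : ∑ j : Fin (k + 1), (if (⟨0, k.succ_pos⟩ : Fin (k + 1)) = j then (1 : ℝ) else 0) •
      arnoldiVec A w j = w := by
    rw [Finset.sum_eq_single ⟨0, k.succ_pos⟩]
    · rw [if_pos rfl, one_smul, h0]
    · intro j _ hj
      rw [if_neg hj.symm, zero_smul]
    · intro h
      exact absurd (Finset.mem_univ _) h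
  have h2 : ∑ j : Fin (k + 1), (∑ l, arnoldiHess A w (k + 1) j l * u l) • arnoldiVec A w j =
      ∑ l : Fin (k + 1), u l • ∑ i ∈ Finset.range (k + 1),
        inner ℝ (arnoldiVec A w i) (A.toEuclideanLin (arnoldiVec A w l)) • arnoldiVec A w i := by
    simp only [Finset.sum_smul, Finset.smul_sum, Finset.sum_range]
    rw [Finset.sum_comm]
    refine Finset.sum_congr rfl fun l _ => Finset.sum_congr rfl fun j _ => ?_
    rw [arnoldiHess_apply, smul_smul, mul_comm]
  -- This is $(AV-VH)u$: all columns but the last vanish.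
  have h3 : ∑ l : Fin (k + 1), u l • (A.toEuclideanLin (arnoldiVec A w l) -
      ∑ i ∈ Finset.range (k + 1), inner ℝ (arnoldiVec A w i)
        (A.toEuclideanLin (arnoldiVec A w l)) • arnoldiVec A w i) =
      u (Fin.last k) • arnoldiRemainder A w k := by
    rw [Fin.sum_univ_castSucc, Finset.sum_eq_zero, zero_add]
    · rfl
    · intro l _
      rw [Fin.val_castSucc, sub_sum_range_eq_zero A w (by omega), smul_zero]
  simp only [sub_smul, Finset.sum_sub_distrib, smul_sub] at h3 ⊢
  rw [h1, h2, neg_smul, ← h3, map_add, map_sum]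
  simp only [map_smul]
  rw [hw]
  abel

/-- The products of two coordinates over an orthonormal eigenvector basis have total variation at
most one. -/
theorem sum_abs_eigenvectorBasis_mul_le {k : ℕ} {H : Matrix (Fin k) (Fin k) ℝ}
    (hH : H.IsHermitian) (j l : Fin k) :
    ∑ i, |hH.eigenvectorBasis i j * hH.eigenvectorBasis i l| ≤ 1 := by
  have h : ∀ j, ∑ i, hH.eigenvectorBasis i j ^ 2 = 1 := fun j => by
    simpa [sq] using sum_eigenvectorBasis_mul hH j j
  have h2 : ∑ i, |hH.eigenvectorBasis i j * hH.eigenvectorBasis i l| ≤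
      ∑ i, (hH.eigenvectorBasis i j ^ 2 + hH.eigenvectorBasis i l ^ 2) / 2 :=
    Finset.sum_le_sum fun i _ => by
      rw [abs_le]
      constructor <;> nlinarith [sq_nonneg (hH.eigenvectorBasis i j + hH.eigenvectorBasis i l),
        sq_nonneg (hH.eigenvectorBasis i j - hH.eigenvectorBasis i l)]
  rw [← Finset.sum_div, Finset.sum_add_distrib, h, h] at h2
  linarith

end Krylov

end

theorem propositionP2 {n : ℕ} (A : Matrix (Fin n) (Fin n) ℝ) (hA : A.IsSymm)
    (c : ℝ) (hc : 0 < c) (hspec : spectrum ℝ A ⊆ Set.Icc 0 (2 * c))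
    (g v : EuclideanSpace ℝ (Fin n)) (hg : ‖g - A.toEuclideanLin v‖ = 1)
    (k : ℕ) (hk : 2 ≤ k) (t : ℝ) (ht : 0 ≤ t) :
    DifferentiableAt ℝ (krylovApprox A g v k) t ∧
    Summable (fun ν : {ν : ℕ // k ≤ ν} =>
      ((ν.1 : ℝ) - k + 2) * ((ν.1 : ℝ) - k + 1) * besselI ν.1 (c * t)) ∧
    ‖krylovResidual A g v k t‖ ≤ 4 * Real.exp (-(c * t)) *
      ∑' ν : {ν : ℕ // k ≤ ν},
        ((ν.1 : ℝ) - k + 2) * ((ν.1 : ℝ) - k + 1) * besselI ν.1 (c * t) := by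
  refine ⟨(hasDerivAt_krylovApprox hA hg (by omega) t).differentiableAt,
    (hasSum_weighted_besselI (by omega) (mul_nonneg hc.le ht)).summable, ?_⟩
  obtain ⟨m, rfl⟩ : ∃ m, k = m + 1 := ⟨k - 1, by omega⟩
  rw [krylovResidual_eq hA hg, norm_smul, norm_neg, Real.norm_eq_abs,
    krylovCoeff_apply hA hg m.succ_pos]
  set w := g - A.toEuclideanLin v
  have h1 := abs_sum_mul_scalarCoeff_le
    (fun i => (isHermitian_arnoldiHess w hA (m + 1)).eigenvectorBasis i ⟨0, m.succ_pos⟩ *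
      (isHermitian_arnoldiHess w hA (m + 1)).eigenvectorBasis i (Fin.last m))
    (isHermitian_arnoldiHess w hA (m + 1)).eigenvalues
    (sum_abs_eigenvectorBasis_mul_le _ _ _) hc
    (eigenvalues_arnoldiHess_mem_Icc w hA (by positivity) hspec (m + 1)) (k := m + 1) (by omega)
    (fun j hj => by
      rw [← pow_apply_eq_sum]
      exact arnoldiHess_pow_apply_zero A w m.succ_pos j _ (by simpa using hj)) ht
  -- The bound $h_{k+1,k}\le2c$ absorbs the factor $c$ in `h1` and doubles the constant 2 to 4.
  have h2 := norm_arnoldiRemainder_le A w hA (by positivity) hspec m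
  refine (mul_le_mul_of_nonneg_left h2 (abs_nonneg _)).trans ?_
  linarith
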